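/- Let $a,b>0$ and $\rho\in\mathbb R$. Let $\mathcal{AC}_0[0,1]$ be the set of absolutely continuous $g:[0,1]\to\mathbb R$ with $g(0)=0$, and let $$\lambda(a,b;\rho)=\sup_{g\in\mathcal{AC}_0[0,1]}\left\{-a\int_0^1e^{bg(x)}\,dx-\frac12\int_0^1\Big(g'(x)-\frac{\rho}{b}\Big)^2dx\right\},$$ where the expression in braces is $-\infty$ if $g'-\rho/b$ is not square integrable. For real $\delta\neq0$ and $\xi>0$ put $$A_1(\delta)=\cosh\frac{\delta}{2}+\frac{\rho}{\delta}\sinh\frac{\delta}{2},\qquad A_2(\xi)=\cos\xi+\frac{\rho}{2\xi}\sin\xi,$$ $$\lambda_1(\delta)=a\left\{1+\sinh^2\frac{\delta}{2}\Big(1-\frac{4\rho}{\delta^2}+\frac{\rho^2}{\delta^2}\Big)-\frac{2-\rho}{\delta}\sinh\delta\right\}+\frac{2\rho}{b^2}\log A_1(\delta)-\frac{\rho^2}{b^2},$$ $$\lambda_2(\xi)=a\left\{1-\sin^2\xi\Big(1+\frac{\rho}{\xi^2}-\frac{\rho^2}{4\xi^2}\Big)+\frac{\rho-2}{2\xi}\sin(2\xi)\right\}+\frac{2\rho}{b^2}\log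 A_2(\xi)-\frac{\rho^2}{b^2},$$ and extend $A_1$, $\lambda_1$ by continuity to $\delta=0$, i.e. $A_1(0)=1+\rho/2$ and $\lambda_1(0)=a(\rho^2/4-1)+\frac{2\rho}{b^2}\log(1+\rho/2)-\frac{\rho^2}{b^2}$. The set of $\xi>0$ with $2\xi\cos\xi+\rho\sin\xi=0$ (that is, $\tan\xi=-2\xi/\rho$ if $\rho\ne0$, and $\cos\xi=0$ if $\rho=0$) has a least element $\xi_{\max}$. Consider the equations $$\text{(i)}\quad \rho^2-\delta^2=2ab^2A_1(\delta)^2,\qquad \delta\in\mathbb R,\ A_1(\delta)>0,$$ $$\text{(ii)}\quad 2\xi^2(4\xi^2+\rho^2)=ab^2(2\xi\cos\xi+\rho\sin\xi)^2,\qquad \xi\in(0,\xi_{\max}),\ A_2(\xi)>0,$$ where the positivity requirements say that the logarithms in $\lambda_1$, $\lambda_2$ are defined. Then: 1. Exactly one of (i) and (ii) has a solution. A solution of (i) is unique up to sign, and a solution of (ii) is unique. 2. If $\delta$ solves (i), then $\lambda(a,b;\rho)=\lambda_1(\delta)$. If $\xi$ solves (ii), then $\lambda(a,b;\rho)=\lambda_2(\xi)$.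 3. The supremum is attained by exactly one $g\in\mathcal{AC}_0[0,1]$. 4. If $\rho>-2$, the positivity requirements are automatic: every real $\delta$ with $\rho^2-\delta^2=2ab^2A_1(\delta)^2$ has $A_1(\delta)>0$, and $A_2>0$ on $(0,\xi_{\max})$. -/

import Mathlib

open MeasureTheory Set
open scoped ENNReal

namespace VarProblem

/-- `𝒜𝒞₀[0,1]`: absolutely continuous on `[0,1]` with `g(0) = 0`. Elements are functions on `ℝ`
of which only the restriction to `[0,1]` matters. -/
def AC₀ : Set (ℝ → ℝ) :=
  {g | AbsolutelyContinuousOnInterval g 0 1 ∧ g 0 = 0}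

/-- The objective functional
`-a ∫₀¹ e^{b g(x)} dx - ½ ∫₀¹ (g'(x) - ρ/b)² dx`, which equals `-∞` when `g' - ρ/b` is not
square integrable. -/
noncomputable def objective (a b ρ : ℝ) (g : ℝ → ℝ) : EReal :=
  ((-a * ∫ x in (0 : ℝ)..1, Real.exp (b * g x) : ℝ) : EReal) -
    ((2⁻¹ * ∫⁻ x in Icc (0 : ℝ) 1, ENNReal.ofReal ((deriv g x - ρ / b) ^ 2) : ℝ≥0∞) : EReal)

/-- The value `λ(a,b;ρ)` of the variational problem. -/
noncomputable def lam (a b ρ : ℝ) : EReal :=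
  ⨆ g ∈ AC₀, objective a b ρ g

/-- `cosh(δ/2) + (ρ/δ) sinh(δ/2)`, extended by continuity to `δ = 0`. -/
noncomputable def hypArg (ρ δ : ℝ) : ℝ :=
  if δ = 0 then 1 + ρ / 2 else Real.cosh (δ / 2) + ρ / δ * Real.sinh (δ / 2)

/-- `cos ξ + (ρ/(2ξ)) sin ξ`; only used for `ξ > 0`. -/
noncomputable def trigArg (ρ ξ : ℝ) : ℝ :=
  Real.cos ξ + ρ / (2 * ξ) * Real.sin ξ

/-- The hyperbolic formula, extended by continuity to `δ = 0`. -/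
noncomputable def lambda₁ (a b ρ δ : ℝ) : ℝ :=
  if δ = 0 then
    a * (ρ ^ 2 / 4 - 1) + 2 / b ^ 2 * ρ * Real.log (hypArg ρ δ) - ρ ^ 2 / b ^ 2
  else
    a * (1 + Real.sinh (δ / 2) ^ 2 * (1 - 4 * ρ / δ ^ 2 + ρ ^ 2 / δ ^ 2)
        - (2 - ρ) / δ * Real.sinh δ)
      + 2 / b ^ 2 * ρ * Real.log (hypArg ρ δ) - ρ ^ 2 / b ^ 2

/-- The trigonometric formula. -/
noncomputable def lambda₂ (a b ρ ξ : ℝ) : ℝ :=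
  a * (1 - Real.sin ξ ^ 2 * (1 + ρ / ξ ^ 2 - ρ ^ 2 / (4 * ξ ^ 2))
      + (ρ - 2) / (2 * ξ) * Real.sin (2 * ξ))
    + 2 * ρ / b ^ 2 * Real.log (trigArg ρ ξ) - ρ ^ 2 / b ^ 2

/-- The equation `ρ² - δ² = 2ab² (cosh(δ/2) + (ρ/δ) sinh(δ/2))²`. -/
def DeltaEq (a b ρ δ : ℝ) : Prop :=
  ρ ^ 2 - δ ^ 2 = 2 * a * b ^ 2 * hypArg ρ δ ^ 2

/-- The equation `2ξ²(4ξ² + ρ²) = ab² (2ξ cos ξ + ρ sin ξ)²`. -/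
def XiEq (a b ρ ξ : ℝ) : Prop :=
  2 * ξ ^ 2 * (4 * ξ ^ 2 + ρ ^ 2) =
    a * b ^ 2 * (2 * ξ * Real.cos ξ + ρ * Real.sin ξ) ^ 2

/-- The positive solutions of `tan ξ = -2ξ/ρ`, with the denominators cleared so that `ρ = 0`
(where the condition reads `cos ξ = 0`) is included. -/
def tanRoots (ρ : ℝ) : Set ℝ :=
  {ξ | 0 < ξ ∧ 2 * ξ * Real.cos ξ + ρ * Real.sin ξ = 0}

/-- For `ρ ≠ 0` clearing the denominators changes nothing. -/
theorem mem_tanRoots_iff {ρ : ℝ} (hρ : ρ ≠ 0) (ξ : ℝ) :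
    ξ ∈ tanRoots ρ ↔ 0 < ξ ∧ Real.cos ξ ≠ 0 ∧ Real.tan ξ = -2 * ξ / ρ := by
  constructor
  · rintro ⟨h0, h⟩
    have hc : Real.cos ξ ≠ 0 := by
      intro hc
      have hs : Real.sin ξ = 0 := by
        rw [hc] at h
        simpa [hρ] using h
      have := Real.sin_sq_add_cos_sq ξ
      rw [hc, hs] at this
      norm_num at this
    refine ⟨h0, hc, ?_⟩
    rw [Real.tan_eq_sin_div_cos, div_eq_div_iff hc hρ]
    linarith
  · rintro ⟨h0, hc, h⟩
    refine ⟨h0, ?_⟩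
    rw [Real.tan_eq_sin_div_cos, div_eq_div_iff hc hρ] at h
    linarith

/-- `ξ_max`, the smallest positive solution of `tan ξ = -2ξ/ρ`. -/
noncomputable def xiMax (ρ : ℝ) : ℝ := sInf (tanRoots ρ)

/-- `δ` solves its equation, and the logarithm in the hyperbolic formula is taken at a positive
number. -/
def IsDelta (a b ρ δ : ℝ) : Prop :=
  DeltaEq a b ρ δ ∧ 0 < hypArg ρ δ

/-- `ξ ∈ (0, ξ_max)` solves its equation, and the logarithm in the trigonometric formula is taken
at a positive number. -/
def IsXi (a b ρ ξ : ℝ) : Prop :=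
  ξ ∈ Ioo 0 (xiMax ρ) ∧ XiEq a b ρ ξ ∧ 0 < trigArg ρ ξ

/-- `g` attains the supremum of the variational problem. -/
def IsOptimiser (a b ρ : ℝ) (g : ℝ → ℝ) : Prop :=
  g ∈ AC₀ ∧ objective a b ρ g = lam a b ρ

end VarProblem

namespace VarProblem

/-! The functional is strictly concave, so any solution of the Euler-Lagrange equation with its
natural boundary condition is the unique maximiser: `IsExtremal.half_integral_sq_le` bounds the gap
below by `½∫(h' - g')²`, and no compactness argument is needed.

The substitution `φ(1 - x) = φ(1) e^{-b g(x)/2}` linearises the equation to `φ'' = κφ`, `φ(0) = 1`,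
`φ'(0) = ρ/2`, leaving one scalar condition on `κ` (`IsProfile`). With `κ = δ²/4` or `κ = -ξ²` this
condition is (i) or (ii), and `φ(1)` is `A₁` or `A₂`. Since `κ` is determined by the maximiser's
value at 1, uniqueness of the maximiser gives `IsProfile.kappa_unique`, hence uniqueness of
solutions and exclusion of (i) by (ii), with no analysis of the transcendental equations. Existence
is the intermediate value theorem (`exists_isDelta_or_isXi`), and the value comes from an explicit
antiderivative. -/

theorem absolutelyContinuousOnInterval_of_hasDerivAt {f f' : ℝ → ℝ} {c d : ℝ} (hcd : c ≤ d)
    (hf : ∀ x ∈ Icc c d, HasDerivAt f (f' x) x) (hf' : ContinuousOn f' (Icc c d)) :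
    AbsolutelyContinuousOnInterval f c d := by
  obtain ⟨C, hC⟩ := isCompact_Icc.exists_bound_of_continuousOn hf'
  have : LipschitzOnWith C.toNNReal f (uIcc c d) := by
    rw [uIcc_of_le hcd]
    refine (convex_Icc c d).lipschitzOnWith_of_nnnorm_hasDerivWithin_le
      (fun x hx => (hf x hx).hasDerivWithinAt) (fun x hx => ?_)
    exact NNReal.le_toNNReal_of_coe_le (by simpa using hC x hx)
  exact this.absolutelyContinuousOnInterval

/-- The value of the objective functional when the energy is finite. -/
noncomputable def realObjective (a b ρ : ℝ) (g : ℝ → ℝ) : ℝ :=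
  (-a * ∫ x in (0 : ℝ)..1, Real.exp (b * g x)) -
    2⁻¹ * ∫ x in (0 : ℝ)..1, (deriv g x - ρ / b) ^ 2

theorem objective_eq_realObjective {a b ρ : ℝ} {g : ℝ → ℝ}
    (hg : IntervalIntegrable (fun x => (deriv g x - ρ / b) ^ 2) volume 0 1) :
    objective a b ρ g = (realObjective a b ρ g : EReal) := by
  have hI : Integrable (fun x => (deriv g x - ρ / b) ^ 2) (volume.restrict (Icc (0 : ℝ) 1)) :=
    (intervalIntegrable_iff_integrableOn_Icc_of_le zero_le_one).1 hg
  have h0 : 0 ≤ ∫ x in Icc (0 : ℝ) 1, (deriv g x - ρ / b) ^ 2 :=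
    integral_nonneg fun x => sq_nonneg _
  rw [objective, realObjective, ← ofReal_integral_eq_lintegral_ofReal hI
    (Filter.Eventually.of_forall fun x => sq_nonneg _), EReal.coe_sub,
    intervalIntegral.integral_of_le zero_le_one (f := fun x => (deriv g x - ρ / b) ^ 2),
    ← integral_Icc_eq_integral_Ioc]
  congr 1
  have h2 : (2⁻¹ : ℝ≥0∞) = ENNReal.ofReal 2⁻¹ := by
    rw [ENNReal.ofReal_inv_of_pos two_pos]; simp
  rw [h2, ← ENNReal.ofReal_mul (by norm_num), EReal.coe_ennreal_ofReal,
    max_eq_left (by positivity)]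

theorem objective_eq_bot {a b ρ : ℝ} {g : ℝ → ℝ}
    (hg : ¬ IntervalIntegrable (fun x => (deriv g x - ρ / b) ^ 2) volume 0 1) :
    objective a b ρ g = ⊥ := by
  have hm : Measurable fun x => (deriv g x - ρ / b) ^ 2 :=
    ((measurable_deriv g).sub_const _).pow_const 2
  have hI : ∫⁻ x in Icc (0 : ℝ) 1, ENNReal.ofReal ((deriv g x - ρ / b) ^ 2) = ⊤ := by
    by_contra hne
    refine hg ((intervalIntegrable_iff_integrableOn_Icc_of_le zero_le_one).2 ?_)
    exact (lintegral_ofReal_ne_top_iff_integrable hm.aestronglyMeasurable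
      (Filter.Eventually.of_forall fun x => sq_nonneg _)).1 hne
  rw [objective, hI, ENNReal.mul_top (by simp)]
  exact EReal.sub_top _

/-! ### Extremals are unique maximisers, by concavity. -/

/-- `g`, with derivative `p`, solves the Euler-Lagrange equation `g'' = a b e^{b g}` on `[0,1]`
with `g(0) = 0` and the natural boundary condition `g'(1) = ρ/b`. -/
structure IsExtremal (a b ρ : ℝ) (g p : ℝ → ℝ) : Prop where
  hasDerivAt : ∀ x ∈ Icc (0 : ℝ) 1, HasDerivAt g (p x) x
  hasDerivAt_deriv : ∀ x ∈ Icc (0 : ℝ) 1, HasDerivAt p (a * b * Real.exp (b * g x)) x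
  map_zero : g 0 = 0
  deriv_one : p 1 = ρ / b

namespace IsExtremal

variable {a b ρ : ℝ} {g p h : ℝ → ℝ}

theorem continuousOn (hg : IsExtremal a b ρ g p) : ContinuousOn g (Icc 0 1) :=
  fun x hx => (hg.hasDerivAt x hx).continuousAt.continuousWithinAt

theorem continuousOn_deriv (hg : IsExtremal a b ρ g p) : ContinuousOn p (Icc 0 1) :=
  fun x hx => (hg.hasDerivAt_deriv x hx).continuousAt.continuousWithinAt

theorem continuousOn_exp (hg : IsExtremal a b ρ g p) :
    ContinuousOn (fun x => Real.exp (b * g x)) (Icc 0 1) :=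
  Real.continuous_exp.comp_continuousOn (hg.continuousOn.const_mul b)

theorem mem_AC₀ (hg : IsExtremal a b ρ g p) : g ∈ AC₀ :=
  ⟨absolutelyContinuousOnInterval_of_hasDerivAt zero_le_one hg.hasDerivAt hg.continuousOn_deriv,
    hg.map_zero⟩

theorem deriv_eqOn (hg : IsExtremal a b ρ g p) : EqOn (deriv g) p (Icc 0 1) :=
  fun x hx => (hg.hasDerivAt x hx).deriv

theorem intervalIntegrable_sq (hg : IsExtremal a b ρ g p) :
    IntervalIntegrable (fun x => (deriv g x - ρ / b) ^ 2) volume 0 1 := by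
  refine ContinuousOn.intervalIntegrable ?_
  rw [uIcc_of_le zero_le_one]
  refine ((hg.continuousOn_deriv.sub (continuousOn_const (c := ρ / b))).pow 2).congr
    fun x hx => ?_
  simp [hg.deriv_eqOn hx]

theorem objective_eq (hg : IsExtremal a b ρ g p) :
    objective a b ρ g = (realObjective a b ρ g : EReal) :=
  objective_eq_realObjective hg.intervalIntegrable_sq

theorem intervalIntegrable_sq_sub (hg : IsExtremal a b ρ g p) (hh : h ∈ AC₀)
    (hi : IntervalIntegrable (fun x => (deriv h x - ρ / b) ^ 2) volume 0 1) :
    IntervalIntegrable (fun x => (deriv h x - p x) ^ 2) volume 0 1 := by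
  have hpc : ContinuousOn (fun x => p x - ρ / b) (uIcc 0 1) := by
    rw [uIcc_of_le zero_le_one]; exact hg.continuousOn_deriv.sub continuousOn_const
  -- Expand `h' - p = (h' - ρ/b) - (p - ρ/b)`; the cross term is an integrable function times a
  -- continuous one.
  have h1 := (hh.1.intervalIntegrable_deriv.sub
    (intervalIntegrable_const (c := ρ / b))).mul_continuousOn hpc
  have h2 := (hi.sub (h1.const_mul 2)).add (hpc.pow 2).intervalIntegrable
  refine h2.congr fun x _ => ?_
  simp only [Pi.pow_apply]
  ring

/-- Integration by parts: the boundary term dies at 1 by the natural condition and at 0 because `h`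
and `g` both vanish there. -/
theorem integral_firstVariation (hg : IsExtremal a b ρ g p) (hh : h ∈ AC₀) :
    ∫ x in (0 : ℝ)..1, (a * b * Real.exp (b * g x) * (h x - g x) +
      (p x - ρ / b) * (deriv h x - p x)) = 0 := by
  have hH : AbsolutelyContinuousOnInterval (fun x => h x - g x) 0 1 := hh.1.fun_sub hg.mem_AC₀.1
  have hP : AbsolutelyContinuousOnInterval (fun x => p x - ρ / b) 0 1 :=
    absolutelyContinuousOnInterval_of_hasDerivAt zero_le_one
      (fun x hx => (hg.hasDerivAt_deriv x hx).sub_const (ρ / b))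
      (hg.continuousOn_exp.const_mul (a * b))
  have key := hP.integral_deriv_mul_eq_sub hH
  have hrhs : (p 1 - ρ / b) * (h 1 - g 1) - (p 0 - ρ / b) * (h 0 - g 0) = 0 := by
    rw [hg.deriv_one, hh.2, hg.map_zero]; ring
  refine Eq.trans ?_ (key.trans hrhs)
  refine intervalIntegral.integral_congr_ae ?_
  filter_upwards [hh.1.ae_differentiableAt] with x hx hx'
  have hx1 : x ∈ uIcc (0 : ℝ) 1 := uIoc_subset_uIcc hx'
  have hx2 : x ∈ Icc (0 : ℝ) 1 := by rwa [uIcc_of_le zero_le_one] at hx1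
  have e1 := ((hg.hasDerivAt_deriv x hx2).sub_const (ρ / b)).deriv
  have e2 := ((hx hx1).hasDerivAt.sub (hg.hasDerivAt x hx2)).deriv
  have e2' : deriv (fun x => h x - g x) x = deriv h x - p x := e2
  rw [e1, e2']

/-- The quadratic part expands exactly about `p`, the exponential lies above its tangent line, and
the linear terms integrate to zero by `integral_firstVariation`. -/
theorem half_integral_sq_le (ha : 0 < a) (hg : IsExtremal a b ρ g p) (hh : h ∈ AC₀)
    (hi : IntervalIntegrable (fun x => (deriv h x - ρ / b) ^ 2) volume 0 1) :
    2⁻¹ * ∫ x in (0 : ℝ)..1, (deriv h x - p x) ^ 2 ≤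
      realObjective a b ρ g - realObjective a b ρ h := by
  have hu : uIcc (0 : ℝ) 1 = Icc 0 1 := uIcc_of_le zero_le_one
  have ieg : IntervalIntegrable (fun x => Real.exp (b * g x)) volume 0 1 :=
    ContinuousOn.intervalIntegrable (hu ▸ hg.continuousOn_exp)
  have ieh : IntervalIntegrable (fun x => Real.exp (b * h x)) volume 0 1 :=
    ContinuousOn.intervalIntegrable
      (Real.continuous_exp.comp_continuousOn (hh.1.continuousOn.const_mul b))
  have isq := hg.intervalIntegrable_sq_sub hh hi
  have hpc : ContinuousOn (fun x => p x - ρ / b) (uIcc 0 1) := by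
    rw [hu]; exact hg.continuousOn_deriv.sub continuousOn_const
  have ifv : IntervalIntegrable (fun x => a * b * Real.exp (b * g x) * (h x - g x) +
      (p x - ρ / b) * (deriv h x - p x)) volume 0 1 := by
    refine IntervalIntegrable.add ?_ ?_
    · refine ContinuousOn.intervalIntegrable ?_
      rw [hu]
      exact (hg.continuousOn_exp.const_mul _).mul ((hu ▸ hh.1.continuousOn).sub hg.continuousOn)
    · refine IntervalIntegrable.continuousOn_mul (hh.1.intervalIntegrable_deriv.sub ?_) hpc
      exact ContinuousOn.intervalIntegrable (hu ▸ hg.continuousOn_deriv)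
  have hlow := (isq.const_mul 2⁻¹).add ifv
  have hup := ((ieh.sub ieg).const_mul a).add ((hi.sub hg.intervalIntegrable_sq).const_mul 2⁻¹)
  have hmono := intervalIntegral.integral_mono_on zero_le_one hlow hup (fun x hx => by
    have e : a * b * Real.exp (b * g x) * (h x - g x) ≤
        a * (Real.exp (b * h x) - Real.exp (b * g x)) := by
      have h1 := Real.add_one_le_exp (b * h x - b * g x)
      have h2 := mul_le_mul_of_nonneg_left h1 (mul_pos ha (Real.exp_pos (b * g x))).le
      rw [mul_assoc a (Real.exp _) (Real.exp _), ← Real.exp_add] at h2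
      rw [show b * g x + (b * h x - b * g x) = b * h x by ring] at h2
      linarith
    simp only [hg.deriv_eqOn hx]
    linarith)
  rw [intervalIntegral.integral_add (isq.const_mul 2⁻¹) ifv, hg.integral_firstVariation hh,
    intervalIntegral.integral_add ((ieh.sub ieg).const_mul a)
      ((hi.sub hg.intervalIntegrable_sq).const_mul 2⁻¹),
    intervalIntegral.integral_const_mul, intervalIntegral.integral_const_mul,
    intervalIntegral.integral_const_mul, intervalIntegral.integral_sub ieh ieg,
    intervalIntegral.integral_sub hi hg.intervalIntegrable_sq] at hmono
  rw [realObjective, realObjective]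
  linarith

theorem objective_le (ha : 0 < a) (hg : IsExtremal a b ρ g p) (hh : h ∈ AC₀) :
    objective a b ρ h ≤ objective a b ρ g := by
  by_cases hi : IntervalIntegrable (fun x => (deriv h x - ρ / b) ^ 2) volume 0 1
  · rw [hg.objective_eq, objective_eq_realObjective hi, EReal.coe_le_coe_iff]
    have h1 := hg.half_integral_sq_le ha hh hi
    have h2 : 0 ≤ ∫ x in (0 : ℝ)..1, (deriv h x - p x) ^ 2 :=
      intervalIntegral.integral_nonneg zero_le_one fun x _ => sq_nonneg _
    linarith
  · rw [objective_eq_bot hi]; exact bot_le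

theorem lam_eq (ha : 0 < a) (hg : IsExtremal a b ρ g p) :
    lam a b ρ = (realObjective a b ρ g : EReal) := by
  rw [← hg.objective_eq]
  exact le_antisymm (iSup₂_le fun h hh => hg.objective_le ha hh)
    (le_iSup₂ (f := fun g _ => objective a b ρ g) g hg.mem_AC₀)

theorem isOptimiser (ha : 0 < a) (hg : IsExtremal a b ρ g p) : IsOptimiser a b ρ g :=
  ⟨hg.mem_AC₀, by rw [hg.lam_eq ha, hg.objective_eq]⟩

theorem eqOn_of_isOptimiser (ha : 0 < a) (hg : IsExtremal a b ρ g p)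
    (hh : IsOptimiser a b ρ h) : EqOn h g (Icc 0 1) := by
  obtain ⟨hh, ho⟩ := hh
  rw [hg.lam_eq ha] at ho
  have hi : IntervalIntegrable (fun x => (deriv h x - ρ / b) ^ 2) volume 0 1 := by
    by_contra hi
    rw [objective_eq_bot hi] at ho
    exact EReal.bot_ne_coe _ ho
  rw [objective_eq_realObjective hi, EReal.coe_eq_coe_iff] at ho
  have h1 := hg.half_integral_sq_le ha hh hi
  have hz : ∫ x in (0 : ℝ)..1, (deriv h x - p x) ^ 2 = 0 :=
    le_antisymm (by linarith) (intervalIntegral.integral_nonneg zero_le_one fun x _ => sq_nonneg _)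
  have isq := hg.intervalIntegrable_sq_sub hh hi
  rw [intervalIntegral.integral_eq_zero_iff_of_le_of_nonneg_ae zero_le_one
    (Filter.Eventually.of_forall fun x => sq_nonneg _) isq] at hz
  have hH : AbsolutelyContinuousOnInterval (fun x => h x - g x) 0 1 := hh.1.fun_sub hg.mem_AC₀.1
  rw [restrict_Ioc_eq_restrict_Icc, Filter.EventuallyEq, ae_restrict_iff' measurableSet_Icc] at hz
  obtain ⟨C, hC⟩ := hH.const_of_ae_hasDerivAt_zero (by
    filter_upwards [hh.1.ae_differentiableAt, hz] with x hx hx0 hx1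
    have hx2 : x ∈ Icc (0 : ℝ) 1 := by rwa [uIcc_of_le zero_le_one] at hx1
    have e := (hx hx1).hasDerivAt.sub (hg.hasDerivAt x hx2)
    have e0 : deriv h x - p x = 0 := by simpa using hx0 hx2
    rw [e0] at e
    exact e)
  rw [uIcc_of_le zero_le_one] at hC
  have hC0 := hC 0 (by simp)
  simp only [hh.2, hg.map_zero] at hC0
  intro x hx
  linarith [hC x hx]

end IsExtremal

/-! ### Linearisation of the Euler-Lagrange equation. -/

/-- `φ`, with derivative `ψ`, solves `φ'' = κ φ` with `φ(0) = 1`, `φ'(0) = ρ/2` and is positive on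
`[0,1]`; moreover `κ` satisfies the self-consistency equation `ρ² - 4κ = 2ab² φ(1)²`. -/
structure IsProfile (a b ρ κ : ℝ) (φ ψ : ℝ → ℝ) : Prop where
  hasDerivAt : ∀ t, HasDerivAt φ (ψ t) t
  hasDerivAt_deriv : ∀ t, HasDerivAt ψ (κ * φ t) t
  map_zero : φ 0 = 1
  deriv_zero : ψ 0 = ρ / 2
  pos : ∀ t ∈ Icc (0 : ℝ) 1, 0 < φ t
  consistent : ρ ^ 2 - 4 * κ = 2 * a * b ^ 2 * φ 1 ^ 2

namespace IsProfile

variable {a b ρ κ : ℝ} {φ ψ : ℝ → ℝ}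

theorem firstIntegral (h : IsProfile a b ρ κ φ ψ) (t : ℝ) :
    ψ t ^ 2 - κ * φ t ^ 2 = a * b ^ 2 / 2 * φ 1 ^ 2 := by
  have hd : ∀ s, HasDerivAt (fun s => ψ s ^ 2 - κ * φ s ^ 2) 0 s := fun s => by
    have := ((h.hasDerivAt_deriv s).pow 2).sub (((h.hasDerivAt s).pow 2).const_mul κ)
    refine this.congr_deriv ?_
    norm_num
    ring
  have := is_const_of_deriv_eq_zero (fun s => (hd s).differentiableAt) (fun s => (hd s).deriv) t 0
  simp only [h.map_zero, h.deriv_zero] at this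
  linarith [h.consistent]

/-- The extremal attached to a profile by the substitution `φ(1 - x) = φ(1) e^{-b g(x)/2}`. -/
noncomputable def extremal (b : ℝ) (φ : ℝ → ℝ) (x : ℝ) : ℝ :=
  2 / b * (Real.log (φ 1) - Real.log (φ (1 - x)))

theorem exp_extremal (hb : 0 < b) (h : IsProfile a b ρ κ φ ψ) {x : ℝ} (hx : x ∈ Icc (0 : ℝ) 1) :
    Real.exp (b * extremal b φ x) = φ 1 ^ 2 / φ (1 - x) ^ 2 := by
  have h1 := h.pos 1 (by simp)
  have h2 := h.pos (1 - x) ⟨by linarith [hx.2], by linarith [hx.1]⟩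
  have e : b * extremal b φ x = Real.log (φ 1 ^ 2 / φ (1 - x) ^ 2) := by
    rw [Real.log_div (by positivity) (by positivity), Real.log_pow, Real.log_pow, extremal]
    field_simp
    push_cast
    ring
  rw [e, Real.exp_log (by positivity)]

/-- By `firstIntegral`, `(log φ)'' = (κφ² - ψ²)/φ²` is `-(ab²/2) φ(1)²/φ²`, and `φ(1)²/φ²` is the
exponential. Reversing time turns the condition at `x = 1` into initial data at `t = 0`. -/
theorem isExtremal (hb : 0 < b) (h : IsProfile a b ρ κ φ ψ) :
    IsExtremal a b ρ (extremal b φ) (fun x => 2 / b * (ψ (1 - x) / φ (1 - x))) where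
  hasDerivAt x hx := by
    have h2 := h.pos (1 - x) ⟨by linarith [hx.2], by linarith [hx.1]⟩
    have hs : HasDerivAt (fun y : ℝ => 1 - y) (-1) x := (hasDerivAt_id x).const_sub 1
    have hφ : HasDerivAt (fun y => φ (1 - y)) (ψ (1 - x) * -1) x :=
      (h.hasDerivAt (1 - x)).comp x hs
    refine (((hφ.log h2.ne').const_sub (Real.log (φ 1))).const_mul (2 / b)).congr_deriv ?_
    ring
  hasDerivAt_deriv x hx := by
    have h2 := h.pos (1 - x) ⟨by linarith [hx.2], by linarith [hx.1]⟩
    have hs : HasDerivAt (fun y : ℝ => 1 - y) (-1) x := (hasDerivAt_id x).const_sub 1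
    have hφ : HasDerivAt (fun y => φ (1 - y)) (ψ (1 - x) * -1) x :=
      (h.hasDerivAt (1 - x)).comp x hs
    have hψ : HasDerivAt (fun y => ψ (1 - y)) (κ * φ (1 - x) * -1) x :=
      (h.hasDerivAt_deriv (1 - x)).comp x hs
    refine ((hψ.div hφ h2.ne').const_mul (2 / b)).congr_deriv ?_
    rw [h.exp_extremal hb hx]
    have := h.firstIntegral (1 - x)
    field_simp
    linarith
  map_zero := by simp [extremal]
  deriv_one := by
    simp only [sub_self, h.map_zero, h.deriv_zero]
    ring

theorem kappa_eq (hb : 0 < b) (h : IsProfile a b ρ κ φ ψ) :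
    4 * κ = ρ ^ 2 - 2 * a * b ^ 2 * Real.exp (b * extremal b φ 1) := by
  rw [h.exp_extremal hb (by simp)]
  simp only [sub_self, h.map_zero]
  linarith [h.consistent]

theorem realObjective_eq (hb : 0 < b) (h : IsProfile a b ρ κ φ ψ) :
    realObjective a b ρ (extremal b φ) =
      (-2 * ρ + 4 * (ψ 1 / φ 1) - 2 * κ + 2 * ρ * Real.log (φ 1) - ρ ^ 2 / 2) / b ^ 2 := by
  have hg := h.isExtremal hb
  set p : ℝ → ℝ := fun x => 2 / b * (ψ (1 - x) / φ (1 - x)) with hp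
  set g := extremal b φ with hgdef
  have hu : uIcc (0 : ℝ) 1 = Icc 0 1 := uIcc_of_le zero_le_one
  have ieg : IntervalIntegrable (fun x => Real.exp (b * g x)) volume 0 1 :=
    ContinuousOn.intervalIntegrable (hu ▸ hg.continuousOn_exp)
  have hint := (ieg.const_mul (-a)).sub (hg.intervalIntegrable_sq.const_mul 2⁻¹)
  -- The first integral reads `½p² = 2κ/b² + a e^{bg}`, so the integrand contains the exponential
  -- only as `-2a e^{bg} = -(2/b)p'`.
  have hd : ∀ x ∈ uIcc (0 : ℝ) 1, HasDerivAt
      (fun x => -(2 / b) * p x - 2 * κ / b ^ 2 * x + ρ / b * g x - ρ ^ 2 / (2 * b ^ 2) * x)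
      (-a * Real.exp (b * g x) - 2⁻¹ * (deriv g x - ρ / b) ^ 2) x := fun x hx => by
    rw [hu] at hx
    have h2 := h.pos (1 - x) ⟨by linarith [hx.2], by linarith [hx.1]⟩
    refine (((((hg.hasDerivAt_deriv x hx).const_mul (-(2 / b))).sub
      ((hasDerivAt_id x).const_mul (2 * κ / b ^ 2))).add
      ((hg.hasDerivAt x hx).const_mul (ρ / b))).sub
      ((hasDerivAt_id x).const_mul (ρ ^ 2 / (2 * b ^ 2)))).congr_deriv ?_
    rw [hg.deriv_eqOn hx, hgdef, h.exp_extremal hb hx]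
    have := h.firstIntegral (1 - x)
    simp only [hp]
    field_simp
    linarith
  have key := intervalIntegral.integral_eq_sub_of_hasDerivAt hd hint
  rw [intervalIntegral.integral_sub (ieg.const_mul (-a)) (hg.intervalIntegrable_sq.const_mul 2⁻¹),
    intervalIntegral.integral_const_mul, intervalIntegral.integral_const_mul] at key
  rw [realObjective, key, hg.deriv_one, hg.map_zero]
  have e0 : p 0 = 2 / b * (ψ 1 / φ 1) := by simp [hp]
  have e1 : g 1 = 2 / b * Real.log (φ 1) := by simp [hgdef, extremal, h.map_zero]
  rw [e0, e1]
  have h1 := h.pos 1 (by simp)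
  field_simp
  ring

theorem lam_eq (ha : 0 < a) (hb : 0 < b) (h : IsProfile a b ρ κ φ ψ) :
    lam a b ρ = ((-2 * ρ + 4 * (ψ 1 / φ 1) - 2 * κ + 2 * ρ * Real.log (φ 1) - ρ ^ 2 / 2) / b ^ 2 :
      ℝ) := by
  rw [(h.isExtremal hb).lam_eq ha, h.realObjective_eq hb]

/-- The maximiser is unique, hence so is the parameter `κ`. -/
theorem kappa_unique (ha : 0 < a) (hb : 0 < b) (h : IsProfile a b ρ κ φ ψ)
    {κ' : ℝ} {φ' ψ' : ℝ → ℝ} (h' : IsProfile a b ρ κ' φ' ψ') : κ = κ' := by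
  have e := (h.isExtremal hb).eqOn_of_isOptimiser ha ((h'.isExtremal hb).isOptimiser ha)
    (x := 1) (by simp)
  have k := h.kappa_eq hb
  have k' := h'.kappa_eq hb
  rw [e] at k'
  linarith

end IsProfile

/-- Common to all cases: `c` is `cosh (δ/2)`, `1` or `cos ξ`, and `σ` is `sinh (δ/2)/δ`, `1/2` or
`sin ξ/(2ξ)`. Then `A = φ(1)` and `2κσ + ρc/2 = ψ(1)`. -/
theorem value_identity {a b ρ κ c σ A : ℝ} (hb : 0 < b) (hA : 0 < A) (hAeq : A = c + ρ * σ)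
    (hc : ρ ^ 2 - 4 * κ = 2 * a * b ^ 2 * A ^ 2) :
    a * (A ^ 2 - 4 * σ * A) - ρ ^ 2 / b ^ 2 =
      (-2 * ρ + 4 * ((2 * κ * σ + ρ / 2 * c) / A) - 2 * κ - ρ ^ 2 / 2) / b ^ 2 := by
  have hcA : c = A - ρ * σ := by linarith
  have ha : a = (ρ ^ 2 - 4 * κ) / (2 * b ^ 2 * A ^ 2) := by
    rw [hc]; field_simp
  rw [hcA, ha]
  field_simp
  ring

/-! ### The hyperbolic case -/

theorem hypArg_of_ne {ρ δ : ℝ} (hδ : δ ≠ 0) :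
    hypArg ρ δ = Real.cosh (δ / 2) + ρ / δ * Real.sinh (δ / 2) := if_neg hδ

theorem hypArg_zero (ρ : ℝ) : hypArg ρ 0 = 1 + ρ / 2 := if_pos rfl

/-- The profile is even in `δ`, and for `δ > 0` it interpolates its endpoint values: `φ(t) sinh(δ/2)
= φ(1) sinh(δt/2) + sinh(δ(1-t)/2)`. -/
theorem hypProfile_pos {ρ δ t : ℝ} (hδ : δ ≠ 0)
    (h1 : 0 < Real.cosh (δ / 2) + ρ / δ * Real.sinh (δ / 2)) (ht : t ∈ Icc (0 : ℝ) 1) :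
    0 < Real.cosh (δ / 2 * t) + ρ / δ * Real.sinh (δ / 2 * t) := by
  wlog hpos : 0 < δ generalizing δ
  · have := this (neg_ne_zero.2 hδ) (by simpa [neg_div, div_neg] using h1)
      (by linarith [lt_of_le_of_ne (not_lt.1 hpos) hδ])
    simpa [neg_div, div_neg] using this
  have hS : 0 < Real.sinh (δ / 2) := Real.sinh_pos_iff.2 (by linarith)
  have key : (Real.cosh (δ / 2 * t) + ρ / δ * Real.sinh (δ / 2 * t)) * Real.sinh (δ / 2) =
      (Real.cosh (δ / 2) + ρ / δ * Real.sinh (δ / 2)) * Real.sinh (δ / 2 * t) +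
        Real.sinh (δ / 2 - δ / 2 * t) := by
    rw [Real.sinh_sub]; ring
  refine pos_of_mul_pos_left (b := Real.sinh (δ / 2)) ?_ hS.le
  rw [key]
  rcases ht.1.eq_or_lt with h0 | h0
  · rw [← h0]; simpa using hS
  · have e1 : 0 < Real.sinh (δ / 2 * t) := Real.sinh_pos_iff.2 (by positivity)
    have e2 : 0 ≤ Real.sinh (δ / 2 - δ / 2 * t) :=
      Real.sinh_nonneg_iff.2 (by nlinarith [ht.2])
    positivity

theorem IsDelta.isProfile {a b ρ δ : ℝ} (h : IsDelta a b ρ δ) (hδ : δ ≠ 0) :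
    IsProfile a b ρ (δ ^ 2 / 4)
      (fun t => Real.cosh (δ / 2 * t) + ρ / δ * Real.sinh (δ / 2 * t))
      (fun t => δ / 2 * Real.sinh (δ / 2 * t) + ρ / 2 * Real.cosh (δ / 2 * t)) where
  hasDerivAt t := by
    have hs : HasDerivAt (fun y : ℝ => δ / 2 * y) (δ / 2) t := by
      simpa using (hasDerivAt_id t).const_mul (δ / 2)
    refine (hs.cosh.add (hs.sinh.const_mul (ρ / δ))).congr_deriv ?_
    field_simp
  hasDerivAt_deriv t := by
    have hs : HasDerivAt (fun y : ℝ => δ / 2 * y) (δ / 2) t := by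
      simpa using (hasDerivAt_id t).const_mul (δ / 2)
    refine ((hs.sinh.const_mul (δ / 2)).add (hs.cosh.const_mul (ρ / 2))).congr_deriv ?_
    field_simp
    ring
  map_zero := by simp
  deriv_zero := by simp
  pos t ht := hypProfile_pos hδ (by rw [← hypArg_of_ne hδ]; exact h.2) ht
  consistent := by
    have := h.1
    rw [DeltaEq, hypArg_of_ne hδ] at this
    rw [mul_one, ← this]
    ring

theorem IsDelta.isProfile_zero {a b ρ : ℝ} (h : IsDelta a b ρ 0) :
    IsProfile a b ρ 0 (fun t => 1 + ρ / 2 * t) (fun _ => ρ / 2) where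
  hasDerivAt t := by
    simpa using ((hasDerivAt_id t).const_mul (ρ / 2)).const_add 1
  hasDerivAt_deriv t := by simpa using hasDerivAt_const t (ρ / 2)
  map_zero := by simp
  deriv_zero := rfl
  pos t ht := by
    have := h.2
    rw [hypArg_zero] at this
    rcases ht.2.eq_or_lt with h1 | h1
    · rw [h1, mul_one]; exact this
    · nlinarith [mul_nonneg ht.1 this.le]
  consistent := by
    have := h.1
    rw [DeltaEq, hypArg_zero] at this
    rw [mul_one, ← this]
    ring

theorem IsDelta.exists_isProfile {a b ρ δ : ℝ} (h : IsDelta a b ρ δ) :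
    ∃ φ ψ, IsProfile a b ρ (δ ^ 2 / 4) φ ψ := by
  rcases eq_or_ne δ 0 with rfl | hδ
  · exact ⟨_, _, by simpa using h.isProfile_zero⟩
  · exact ⟨_, _, h.isProfile hδ⟩

theorem IsDelta.lam_eq {a b ρ δ : ℝ} (ha : 0 < a) (hb : 0 < b) (h : IsDelta a b ρ δ) :
    lam a b ρ = (lambda₁ a b ρ δ : EReal) := by
  rcases eq_or_ne δ 0 with rfl | hδ
  · have hp := h.isProfile_zero
    rw [hp.lam_eq ha hb, EReal.coe_eq_coe_iff, lambda₁, if_pos rfl]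
    have key := value_identity (σ := 2⁻¹) (c := 1) hb (hp.pos 1 (by simp)) (by ring)
      hp.consistent
    have e : a * (ρ ^ 2 / 4 - 1) =
        a * ((1 + ρ / 2 * 1) ^ 2 - 4 * 2⁻¹ * (1 + ρ / 2 * 1)) := by ring
    rw [e, hypArg_zero, mul_one] at *
    linear_combination -key
  · have hp := h.isProfile hδ
    rw [hp.lam_eq ha hb, EReal.coe_eq_coe_iff, lambda₁, if_neg hδ, hypArg_of_ne hδ]
    have key := value_identity (σ := Real.sinh (δ / 2) / δ) (c := Real.cosh (δ / 2)) hb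
      (hp.pos 1 (by simp)) (by rw [mul_one]; ring) hp.consistent
    simp only [mul_one] at key ⊢
    have e1 : 2 * (δ ^ 2 / 4) * (Real.sinh (δ / 2) / δ) = δ / 2 * Real.sinh (δ / 2) := by
      field_simp
      norm_num
    have e : 1 + Real.sinh (δ / 2) ^ 2 * (1 - 4 * ρ / δ ^ 2 + ρ ^ 2 / δ ^ 2)
        - (2 - ρ) / δ * Real.sinh δ =
        (Real.cosh (δ / 2) + ρ / δ * Real.sinh (δ / 2)) ^ 2 - 4 * (Real.sinh (δ / 2) / δ) *
          (Real.cosh (δ / 2) + ρ / δ * Real.sinh (δ / 2)) := by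
      have e2 : Real.sinh δ = 2 * Real.sinh (δ / 2) * Real.cosh (δ / 2) := by
        rw [← Real.sinh_two_mul]; congr 1; ring
      have e3 := Real.cosh_sq (δ / 2)
      rw [e2]
      linear_combination (-1 : ℝ) * e3
    rw [e1] at key
    rw [e]
    linear_combination -key

/-! ### The trigonometric case -/

theorem two_mul_mul_trigArg {ρ ξ : ℝ} (hξ : ξ ≠ 0) :
    2 * ξ * trigArg ρ ξ = 2 * ξ * Real.cos ξ + ρ * Real.sin ξ := by
  rw [trigArg]; field_simp

/-- The same interpolation with sines, whose signs are controlled by `ξ < π`. -/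
theorem trigProfile_pos {ρ ξ t : ℝ} (hξ : 0 < ξ) (hπ : ξ < Real.pi) (h1 : 0 < trigArg ρ ξ)
    (ht : t ∈ Icc (0 : ℝ) 1) :
    0 < Real.cos (ξ * t) + ρ / (2 * ξ) * Real.sin (ξ * t) := by
  have hS : 0 < Real.sin ξ := Real.sin_pos_of_pos_of_lt_pi hξ hπ
  have key : (Real.cos (ξ * t) + ρ / (2 * ξ) * Real.sin (ξ * t)) * Real.sin ξ =
      trigArg ρ ξ * Real.sin (ξ * t) + Real.sin (ξ - ξ * t) := by
    rw [Real.sin_sub, trigArg]; ring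
  refine pos_of_mul_pos_left (b := Real.sin ξ) ?_ hS.le
  rw [key]
  have hle : ξ * t ≤ ξ := mul_le_of_le_one_right hξ.le ht.2
  rcases ht.1.eq_or_lt with h0 | h0
  · rw [← h0]; simpa using hS
  · have hpos : 0 < ξ * t := mul_pos hξ h0
    have e1 : 0 < Real.sin (ξ * t) := Real.sin_pos_of_pos_of_lt_pi hpos (by linarith)
    have e2 : 0 ≤ Real.sin (ξ - ξ * t) :=
      Real.sin_nonneg_of_nonneg_of_le_pi (by linarith) (by linarith)
    positivity

theorem xiEq_iff {a b ρ ξ : ℝ} (hξ : ξ ≠ 0) :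
    XiEq a b ρ ξ ↔ ρ ^ 2 + 4 * ξ ^ 2 = 2 * a * b ^ 2 * trigArg ρ ξ ^ 2 := by
  rw [XiEq, ← two_mul_mul_trigArg hξ]
  have h2 : (2 * ξ ^ 2 : ℝ) ≠ 0 := by positivity
  rw [← mul_right_inj' h2 (b := ρ ^ 2 + 4 * ξ ^ 2)]
  constructor <;> intro h <;> linarith

theorem isProfile_trig {a b ρ ξ : ℝ} (hξ : 0 < ξ) (hπ : ξ < Real.pi) (hA : 0 < trigArg ρ ξ)
    (h : XiEq a b ρ ξ) :
    IsProfile a b ρ (-ξ ^ 2)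
      (fun t => Real.cos (ξ * t) + ρ / (2 * ξ) * Real.sin (ξ * t))
      (fun t => -ξ * Real.sin (ξ * t) + ρ / 2 * Real.cos (ξ * t)) where
  hasDerivAt t := by
    have hs : HasDerivAt (fun y : ℝ => ξ * y) ξ t := by
      simpa using (hasDerivAt_id t).const_mul ξ
    refine (hs.cos.add (hs.sin.const_mul (ρ / (2 * ξ)))).congr_deriv ?_
    field_simp
  hasDerivAt_deriv t := by
    have hs : HasDerivAt (fun y : ℝ => ξ * y) ξ t := by
      simpa using (hasDerivAt_id t).const_mul ξ
    refine ((hs.sin.const_mul (-ξ)).add (hs.cos.const_mul (ρ / 2))).congr_deriv ?_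
    field_simp
    ring
  map_zero := by simp
  deriv_zero := by simp
  pos t ht := trigProfile_pos hξ hπ hA ht
  consistent := by
    have := (xiEq_iff hξ.ne').1 h
    rw [trigArg] at this
    rw [mul_one, ← this]
    ring

theorem lam_eq_lambda₂ {a b ρ ξ : ℝ} (ha : 0 < a) (hb : 0 < b) (hξ : 0 < ξ) (hπ : ξ < Real.pi)
    (hA : 0 < trigArg ρ ξ) (h : XiEq a b ρ ξ) :
    lam a b ρ = (lambda₂ a b ρ ξ : EReal) := by
  have hp := isProfile_trig hξ hπ hA h
  rw [hp.lam_eq ha hb, EReal.coe_eq_coe_iff, lambda₂, trigArg]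
  have key := value_identity (σ := Real.sin ξ / (2 * ξ)) (c := Real.cos ξ) hb
    (hp.pos 1 (by simp)) (by rw [mul_one]; ring) hp.consistent
  simp only [mul_one] at key ⊢
  have e1 : 2 * -ξ ^ 2 * (Real.sin ξ / (2 * ξ)) = -ξ * Real.sin ξ := by
    field_simp
  have e : 1 - Real.sin ξ ^ 2 * (1 + ρ / ξ ^ 2 - ρ ^ 2 / (4 * ξ ^ 2))
      + (ρ - 2) / (2 * ξ) * Real.sin (2 * ξ) =
      (Real.cos ξ + ρ / (2 * ξ) * Real.sin ξ) ^ 2 - 4 * (Real.sin ξ / (2 * ξ)) *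
        (Real.cos ξ + ρ / (2 * ξ) * Real.sin ξ) := by
    have e3 := Real.sin_sq_add_cos_sq ξ
    rw [Real.sin_two_mul]
    field_simp
    linear_combination (-16 * ξ ^ 2 : ℝ) * e3
  rw [e1] at key
  rw [e]
  linear_combination -key

/-! ### The least positive root `ξ_max` -/

/-- This is strict decrease of `x cot x` on `(0, π)`. The addition formulas reduce it to `sin s / s
< sin d / d` for `d = y - x < s = x + y`: concavity of sine if `s ≤ π`, a sign comparison otherwise.
-/
theorem mul_cos_mul_sin_lt {x y : ℝ} (hx : 0 < x) (hxy : x < y) (hy : y < Real.pi) :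
    y * Real.cos y * Real.sin x < x * Real.cos x * Real.sin y := by
  have hd : 0 < y - x := sub_pos.2 hxy
  have hs : 0 < x + y := by linarith
  have hsin : 0 < Real.sin (y - x) := Real.sin_pos_of_pos_of_lt_pi hd (by linarith)
  have key : (y - x) * Real.sin (x + y) < (x + y) * Real.sin (y - x) := by
    rcases le_or_gt (x + y) Real.pi with h | h
    · have hc := strictConcaveOn_sin_Icc.2 (show x + y ∈ _ from ⟨hs.le, h⟩)
        (show (0 : ℝ) ∈ _ from ⟨le_rfl, Real.pi_pos.le⟩) hs.ne'
        (show 0 < (y - x) / (x + y) by positivity)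
        (show 0 < 1 - (y - x) / (x + y) by rw [sub_pos, div_lt_one hs]; linarith) (by ring)
      simp only [smul_eq_mul, Real.sin_zero, mul_zero, add_zero, div_mul_cancel₀ _ hs.ne'] at hc
      rw [div_mul_eq_mul_div, div_lt_iff₀ hs] at hc
      linarith
    · have h0 : Real.sin (x + y) ≤ 0 := by
        have := Real.sin_nonneg_of_nonneg_of_le_pi (x := x + y - Real.pi) (by linarith)
          (by linarith)
        rw [Real.sin_sub_pi] at this
        linarith
      nlinarith
  rw [Real.sin_add, Real.sin_sub] at key
  linarith

theorem tanRoots_isLeast (ρ : ℝ) : IsLeast (tanRoots ρ) (xiMax ρ) := by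
  by_cases hex : ∃ x ∈ tanRoots ρ, x < Real.pi
  · obtain ⟨x, hx, hxπ⟩ := hex
    have hl : IsLeast (tanRoots ρ) x := by
      refine ⟨hx, fun y hy => ?_⟩
      by_contra! hlt
      have h1 := mul_cos_mul_sin_lt hy.1 hlt hxπ
      have e1 := hx.2
      have e2 := hy.2
      have : 2 * (x * Real.cos x * Real.sin y) = 2 * (y * Real.cos y * Real.sin x) := by
        linear_combination Real.sin y * e1 - Real.sin x * e2
      linarith
    rw [xiMax, hl.csInf_eq]
    exact hl
  -- With no root below `π`, the root set is closed: it stays away from 0, where the expression also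
  -- vanishes. The values `-2π` at `π` and `4π` at `2π` provide a root.
  · push Not at hex
    have hcont : Continuous fun ξ : ℝ => 2 * ξ * Real.cos ξ + ρ * Real.sin ξ := by fun_prop
    have hset : tanRoots ρ = Ici Real.pi ∩ {ξ | 2 * ξ * Real.cos ξ + ρ * Real.sin ξ = 0} := by
      ext ξ
      exact ⟨fun h => ⟨hex ξ h, h.2⟩, fun h => ⟨Real.pi_pos.trans_le h.1, h.2⟩⟩
    have hclosed : IsClosed (tanRoots ρ) := by
      rw [hset]
      exact isClosed_Ici.inter (isClosed_eq hcont continuous_const)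
    have hne : (tanRoots ρ).Nonempty := by
      have hπ := Real.pi_pos
      obtain ⟨ξ, hξ, h0⟩ := intermediate_value_Icc (a := Real.pi) (b := 2 * Real.pi)
        (by linarith) hcont.continuousOn (show (0 : ℝ) ∈ _ by
          simp only [Real.cos_pi, Real.sin_pi, Real.cos_two_pi, Real.sin_two_pi, mem_Icc]
          constructor <;> linarith)
      exact ⟨ξ, hπ.trans_le hξ.1, h0⟩
    have hbdd : BddBelow (tanRoots ρ) := ⟨0, fun ξ hξ => hξ.1.le⟩
    exact ⟨hclosed.csInf_mem hne hbdd, fun y hy => csInf_le hbdd hy⟩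

/-- On `(0, ξ_max)` the function `A₂` has no zero. -/
theorem no_root_lt_xiMax {ρ ξ : ℝ} (h0 : 0 < ξ) (hξ : ξ < xiMax ρ) :
    2 * ξ * Real.cos ξ + ρ * Real.sin ξ ≠ 0 :=
  fun h => absurd ((tanRoots_isLeast ρ).2 ⟨h0, h⟩) (not_le.2 hξ)

/-- For `ρ ≤ -2`, `ξ_max` lies beyond `π`, so positivity of `A₂` must enter: `2ξA₂(ξ)` is negative
at `π`, and a positive value later would force a root before `ξ_max`. -/
theorem IsXi.lt_pi {a b ρ ξ : ℝ} (h : IsXi a b ρ ξ) : ξ < Real.pi := by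
  obtain ⟨⟨h0, hm⟩, -, hA⟩ := h
  by_contra! hle
  have hπ := Real.pi_pos
  have hcont : Continuous fun ξ : ℝ => 2 * ξ * Real.cos ξ + ρ * Real.sin ξ := by fun_prop
  have hpos : 0 < 2 * ξ * Real.cos ξ + ρ * Real.sin ξ := by
    rw [← two_mul_mul_trigArg h0.ne']; positivity
  obtain ⟨η, hη, hη0⟩ := intermediate_value_Icc hle hcont.continuousOn (show (0 : ℝ) ∈ _ by
    simp only [Real.cos_pi, Real.sin_pi, mem_Icc]
    constructor <;> linarith)
  exact no_root_lt_xiMax (hπ.trans_le hη.1) (hη.2.trans_lt hm) hη0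

theorem IsXi.isProfile {a b ρ ξ : ℝ} (h : IsXi a b ρ ξ) :
    ∃ φ ψ, IsProfile a b ρ (-ξ ^ 2) φ ψ :=
  ⟨_, _, isProfile_trig h.1.1 h.lt_pi h.2.2 h.2.1⟩

/-! ### Positivity for `ρ > -2`, and existence of a solution. -/

/-- The continuous extension of `A₂` to the real line. -/
noncomputable def trigArgExt (ρ ξ : ℝ) : ℝ := Real.cos ξ + ρ / 2 * Real.sinc ξ

theorem trigArgExt_of_ne {ρ ξ : ℝ} (h : ξ ≠ 0) : trigArgExt ρ ξ = trigArg ρ ξ := by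
  rw [trigArgExt, trigArg, Real.sinc_of_ne_zero h]
  field_simp

theorem trigArgExt_zero (ρ : ℝ) : trigArgExt ρ 0 = 1 + ρ / 2 := by simp [trigArgExt]

theorem continuous_trigArgExt (ρ : ℝ) : Continuous (trigArgExt ρ) :=
  Real.continuous_cos.add (Real.continuous_sinc.const_mul _)

theorem trigArg_pos {ρ ξ : ℝ} (hρ : -2 < ρ) (hξ : ξ ∈ Ioo 0 (xiMax ρ)) : 0 < trigArg ρ ξ := by
  by_contra! hle
  rw [← trigArgExt_of_ne hξ.1.ne'] at hle
  obtain ⟨η, hη, hη0⟩ := intermediate_value_Icc' hξ.1.le (continuous_trigArgExt ρ).continuousOn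
    (show (0 : ℝ) ∈ _ from ⟨hle, by rw [trigArgExt_zero]; linarith⟩)
  have hpos : 0 < η := by
    refine lt_of_le_of_ne hη.1 fun h => ?_
    rw [← h, trigArgExt_zero] at hη0
    linarith
  refine no_root_lt_xiMax hpos (hη.2.trans_lt hξ.2) ?_
  rw [← two_mul_mul_trigArg hpos.ne', ← trigArgExt_of_ne hpos.ne', hη0, mul_zero]

theorem hypArg_pos {ρ : ℝ} (hρ : -2 < ρ) (δ : ℝ) : 0 < hypArg ρ δ := by
  rcases eq_or_ne δ 0 with rfl | hδ
  · rw [hypArg_zero]; linarith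
  rw [hypArg_of_ne hδ]
  wlog hpos : 0 < δ generalizing δ
  · simpa [neg_div, div_neg] using this (-δ) (neg_ne_zero.2 hδ)
      (by linarith [lt_of_le_of_ne (not_lt.1 hpos) hδ])
  have hS : 0 < Real.sinh (δ / 2) := Real.sinh_pos_iff.2 (by linarith)
  -- This settles the borderline `ρ = -2`; a larger `ρ` only increases `A₁`.
  have hle : Real.sinh (δ / 2) ≤ δ / 2 * Real.cosh (δ / 2) := by
    have hmono : MonotoneOn (fun x => x * Real.cosh x - Real.sinh x) (Ici 0) := by
      refine monotoneOn_of_deriv_nonneg (convex_Ici 0) (by fun_prop) (by fun_prop)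
        fun x hx => ?_
      rw [interior_Ici, mem_Ioi] at hx
      have : HasDerivAt (fun x => x * Real.cosh x - Real.sinh x) (x * Real.sinh x) x := by
        refine (((hasDerivAt_id x).mul (Real.hasDerivAt_cosh x)).sub
          (Real.hasDerivAt_sinh x)).congr_deriv ?_
        simp
      rw [this.deriv]
      exact mul_nonneg hx.le (Real.sinh_nonneg_iff.2 hx.le)
    have := hmono (a := 0) (by simp) (b := δ / 2) (by simp; linarith) (by linarith)
    simp only [Real.sinh_zero, zero_mul, sub_zero] at this
    linarith
  have e : Real.cosh (δ / 2) + ρ / δ * Real.sinh (δ / 2) =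
      (δ * Real.cosh (δ / 2) + ρ * Real.sinh (δ / 2)) / δ := by field_simp
  rw [e]
  refine div_pos ?_ hpos
  nlinarith

theorem continuous_hypArg (ρ : ℝ) : Continuous (hypArg ρ) := by
  have hd : Continuous (dslope Real.sinh 0) := by
    rw [← continuousOn_univ, continuousOn_dslope Filter.univ_mem]
    exact ⟨Real.continuous_sinh.continuousOn, Real.differentiable_sinh 0⟩
  have e : hypArg ρ = fun δ => Real.cosh (δ / 2) + ρ / 2 * dslope Real.sinh 0 (δ / 2) := by
    funext δ
    rcases eq_or_ne δ 0 with rfl | hδ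
    · simp [hypArg_zero]
    · rw [hypArg_of_ne hδ, dslope_of_ne _ (by simpa using hδ), slope_def_field]
      simp
      field_simp
  rw [e]
  fun_prop

theorem hypArg_abs (ρ : ℝ) : hypArg ρ |ρ| = Real.exp (ρ / 2) := by
  rcases eq_or_ne ρ 0 with rfl | hρ
  · simp [hypArg_zero]
  rw [hypArg_of_ne (abs_ne_zero.2 hρ), ← Real.cosh_add_sinh]
  rcases abs_choice ρ with h | h <;> rw [h]
  · rw [div_self hρ, one_mul]
  · rw [div_neg, div_self hρ, neg_div, Real.cosh_neg, Real.sinh_neg]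
    ring

/-- The sign of the consistency defect at `κ = 0` selects the branch. If it is nonnegative, it
becomes nonpositive at `δ = |ρ|`; if negative, it becomes positive at `ξ_max`, where `A₂` vanishes.
Truncating `A₁` at 0 covers `ρ ≤ -2` and discards roots with `A₁ ≤ 0`. -/
theorem exists_isDelta_or_isXi {a b ρ : ℝ} (ha : 0 < a) (hb : 0 < b) :
    (∃ δ, IsDelta a b ρ δ) ∨ ∃ ξ, IsXi a b ρ ξ := by
  have hab : 0 < 2 * a * b ^ 2 := by positivity
  rcases le_or_gt 0 (ρ ^ 2 - 2 * a * b ^ 2 * max (1 + ρ / 2) 0 ^ 2) with h0 | h0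
  · left
    have hcont : Continuous fun δ => ρ ^ 2 - δ ^ 2 - 2 * a * b ^ 2 * max (hypArg ρ δ) 0 ^ 2 := by
      have := continuous_hypArg ρ
      fun_prop
    obtain ⟨δ, hδ, hδ0⟩ := intermediate_value_Icc' (abs_nonneg ρ) hcont.continuousOn
      (show (0 : ℝ) ∈ _ by
        refine ⟨?_, ?_⟩
        · simp only [sq_abs, sub_self, zero_sub, Left.neg_nonpos_iff]
          positivity
        · simpa [hypArg_zero] using h0)
    simp only at hδ0
    have hpos : 0 < hypArg ρ δ := by
      -- A root where the truncation is active has `δ² = ρ²`, but there `A₁ = e^{ρ/2} > 0`.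
      by_contra! hle
      rw [max_eq_right hle] at hδ0
      have : δ = |ρ| := by
        rw [← abs_of_nonneg hδ.1, ← sq_eq_sq_iff_abs_eq_abs]
        linarith
      rw [this, hypArg_abs] at hle
      exact absurd (Real.exp_pos _) (not_lt.2 hle)
    rw [max_eq_left hpos.le] at hδ0
    exact ⟨δ, sub_eq_zero.1 hδ0, hpos⟩
  · right
    have hρ : -2 < ρ := by
      by_contra! hle
      rw [max_eq_right (by linarith)] at h0
      nlinarith [sq_nonneg ρ]
    rw [max_eq_left (by linarith)] at h0
    have hm := tanRoots_isLeast ρ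
    have hm0 : 0 < xiMax ρ := hm.1.1
    have hmA : trigArgExt ρ (xiMax ρ) = 0 := by
      have := two_mul_mul_trigArg (ρ := ρ) hm0.ne'
      rw [hm.1.2] at this
      rw [trigArgExt_of_ne hm0.ne']
      exact (mul_eq_zero.1 this).resolve_left (by positivity)
    have hcont : Continuous fun ξ => ρ ^ 2 + 4 * ξ ^ 2 - 2 * a * b ^ 2 * trigArgExt ρ ξ ^ 2 := by
      have := continuous_trigArgExt ρ
      fun_prop
    obtain ⟨ξ, hξ, hξ0⟩ := intermediate_value_Ioo hm0.le hcont.continuousOn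
      (show (0 : ℝ) ∈ _ by
        refine ⟨?_, ?_⟩
        · simpa [trigArgExt_zero] using h0
        · simp only [hmA, zero_pow two_ne_zero, mul_zero, sub_zero]
          positivity)
    refine ⟨ξ, hξ, (xiEq_iff hξ.1.ne').2 ?_, trigArg_pos hρ hξ⟩
    rw [← trigArgExt_of_ne hξ.1.ne']
    exact sub_eq_zero.1 hξ0

end VarProblem

theorem mainTheorem6 (a b ρ : ℝ) (ha : 0 < a) (hb : 0 < b) :
    -- `ξ_max` is well defined
    IsLeast (VarProblem.tanRoots ρ) (VarProblem.xiMax ρ) ∧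
    -- exactly one of the two equations has a solution
    Xor (∃ δ, VarProblem.IsDelta a b ρ δ) (∃ ξ, VarProblem.IsXi a b ρ ξ) ∧
    -- `δ` is unique up to sign, and `ξ` is unique
    (∀ δ δ', VarProblem.IsDelta a b ρ δ → VarProblem.IsDelta a b ρ δ' → |δ| = |δ'|) ∧
    (∀ ξ ξ', VarProblem.IsXi a b ρ ξ → VarProblem.IsXi a b ρ ξ' → ξ = ξ') ∧
    -- the explicit value
    (∀ δ, VarProblem.IsDelta a b ρ δ →
      VarProblem.lam a b ρ = ((VarProblem.lambda₁ a b ρ δ : ℝ) : EReal)) ∧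
    (∀ ξ, VarProblem.IsXi a b ρ ξ →
      VarProblem.lam a b ρ = ((VarProblem.lambda₂ a b ρ ξ : ℝ) : EReal)) ∧
    -- the optimiser exists and is unique as a function on `[0,1]`
    (∃ g, VarProblem.IsOptimiser a b ρ g ∧
      ∀ h, VarProblem.IsOptimiser a b ρ h → Set.EqOn h g (Set.Icc 0 1)) ∧
    -- for `ρ > -2` the positivity of the arguments of the logarithms is automatic
    (-2 < ρ →
      (∀ δ, VarProblem.DeltaEq a b ρ δ → 0 < VarProblem.hypArg ρ δ) ∧
      (∀ ξ ∈ Set.Ioo 0 (VarProblem.xiMax ρ), 0 < VarProblem.trigArg ρ ξ)) := by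
  -- A common `κ` would be both `δ²/4 ≥ 0` and `-ξ² < 0`.
  open VarProblem in
  have hxor : ¬ ((∃ δ, IsDelta a b ρ δ) ∧ ∃ ξ, IsXi a b ρ ξ) := by
    rintro ⟨⟨δ, hδ⟩, ξ, hξ⟩
    obtain ⟨_, _, p⟩ := hδ.exists_isProfile
    obtain ⟨_, _, q⟩ := hξ.isProfile
    have e := p.kappa_unique ha hb q
    have := hξ.1.1
    nlinarith [sq_nonneg δ]
  open VarProblem in
  have hopt : ∃ κ φ ψ, IsProfile a b ρ κ φ ψ := by
    rcases exists_isDelta_or_isXi (ρ := ρ) ha hb with ⟨δ, h⟩ | ⟨ξ, h⟩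
    · exact ⟨_, h.exists_isProfile⟩
    · exact ⟨_, h.isProfile⟩
  refine ⟨VarProblem.tanRoots_isLeast ρ, ?_, ?_, ?_, fun δ h => h.lam_eq ha hb,
    fun ξ h => VarProblem.lam_eq_lambda₂ ha hb h.1.1 h.lt_pi h.2.2 h.2.1, ?_,
    fun hρ => ⟨fun δ _ => VarProblem.hypArg_pos hρ δ, fun ξ hξ => VarProblem.trigArg_pos hρ hξ⟩⟩
  · rw [xor_iff_or_and_not_and]
    exact ⟨VarProblem.exists_isDelta_or_isXi ha hb, hxor⟩
  · intro δ δ' h h'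
    obtain ⟨_, _, p⟩ := h.exists_isProfile
    obtain ⟨_, _, q⟩ := h'.exists_isProfile
    have e := p.kappa_unique ha hb q
    rw [← sq_eq_sq_iff_abs_eq_abs]
    linarith
  · intro ξ ξ' h h'
    obtain ⟨_, _, p⟩ := h.isProfile
    obtain ⟨_, _, q⟩ := h'.isProfile
    have e := p.kappa_unique ha hb q
    exact (sq_eq_sq₀ h.1.1.le h'.1.1.le).1 (by linarith)
  · obtain ⟨κ, φ, ψ, p⟩ := hopt
    have hg := p.isExtremal hb
    exact ⟨_, hg.isOptimiser ha, fun h hh => hg.eqOn_of_isOptimiser ha hh⟩
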